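/- Functions on the circle $\mathbb S^1=\mathbb R/\mathbb Z$ are regarded as functions on $\mathbb R$ of period $1$, and $\int$ denotes the integral over one period. Let $(B^1,B^0)$ be either $(C^1(\mathbb S^1),C^0(\mathbb S^1))$ or $(H^1(\mathbb S^1),L^2(\mathbb S^1))$, where $H^1(\mathbb S^1)$ consists of the periodic absolutely continuous real functions with derivative in $L^2$. Let $f:\mathbb R\to\mathbb R$ be smooth, and let $F,\hat F:B^1\to B^0$ be $$F(u)(t)=u'(t)+f(u(t)),\qquad \hat F(u)(t)=u'(t)+\int f(u(s))\,ds .$$ Critical strata. For $G\in\{F,\hat F\}$ let $\Psi_G:B^1\to B^0$, $\Psi_G(u)=G(u)-\int G(u)+\int u$ (this map is bijective), and let $\phi_G(p)=\int G(\Psi_G^{-1}(p))$ for $p\in B^0$, so that in the coordinates $p=\Psi_G(u)=\tilde v+\bar u$ (with $\tilde v$ of mean zero and $\bar u$ constant) the operator $G$ becomes $(\tilde v,\bar u)\mapsto(\tilde v,\phi_G(\tilde v+\bar u))$. For $k\in\mathbb N$ the $k$-th critical stratum of $G$ is $$\Big\{u\in B^1 \;\Big|\; \frac{d^i}{ds^i}\Big|_{s=0}\phi_G(\Psi_G(u)+s)=0,\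 i=1,\dots,k\Big\},$$ where $s$ stands for the constant function. Write $S_k$ for the $k$-th critical stratum of $F$ and $\hat S_k$ for that of $\hat F$; the latter is the set of those $u\in B^1$ with $\int f^{(i)}(u(t))\,dt=0$ for $i=1,\dots,k$. Let $\hat\gamma_k:\mathbb R\to\mathbb R^k$, $\hat\gamma_k(x)=(f'(x),\dots,f^{(k)}(x))$. The function $f$ is called $k$-good if $\hat\gamma_k$ never vanishes and the image under $\hat\gamma_k$ of any nonempty open interval is not contained in a hyperplane through the origin of $\mathbb R^k$. **Lemma.** Let $f$ be smooth and $k$-good. Then, in each of the two cases for $(B^1,B^0)$, 1. $\hat S_k\neq\varnothing$ if and only if $0\in\mathbb R^k$ is in the interior of the convex hull of the image of $\hat\gamma_k$; 2. if $\hat S_k\neq\varnothing$, then $S_k\neq\varnothing$. -/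

import Mathlib

open Set MeasureTheory
open scoped ContDiff

namespace PeriodicODE

noncomputable section

/-! Functions on the circle `ℝ / ℤ` are written as `1`-periodic functions on `ℝ`,
and integrals over the circle as integrals over `(0, 1]`. -/

/-! ### Critical strata of an operator through global adapted coordinates -/

section Strata

variable {B₁ B₀ : Type*} [Nonempty B₁] [AddCommGroup B₀] [Module ℝ B₀]

/-- `Ψ(u) = (G(u) - mean of G(u)) + mean of u`: the map from `B₁` to `B₀` which brings `G` to
adapted coordinates.  Here `m₁`, `m₀` are the mean values on `B₁`, `B₀` and `e` is the constant
function `1` in `B₀`. -/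
def adaptedMap (m₁ : B₁ → ℝ) (m₀ : B₀ → ℝ) (e : B₀) (G : B₁ → B₀) (u : B₁) : B₀ :=
  (G u - m₀ (G u) • e) + m₁ u • e

/-- The height `φ`, that is the mean of `G ∘ Ψ⁻¹`, so that in the coordinates
`B₀ = {mean zero} ⊕ ⟨1⟩` the map `G ∘ Ψ⁻¹` is `(ṽ, ū) ↦ (ṽ, φ(ṽ, ū))`. -/
def height (m₁ : B₁ → ℝ) (m₀ : B₀ → ℝ) (e : B₀) (G : B₁ → B₀) (p : B₀) : ℝ :=
  m₀ (G (Function.invFun (adaptedMap m₁ m₀ e G) p))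

/-- The `k`-th critical stratum of `G`: the points `u` at which the first `k` derivatives of `φ` in
the direction of the constant functions vanish at `Ψ(u)`. -/
def stratum (m₁ : B₁ → ℝ) (m₀ : B₀ → ℝ) (e : B₀) (G : B₁ → B₀) (k : ℕ) : Set B₁ :=
  {u | ∀ i : ℕ, 1 ≤ i → i ≤ k →
    iteratedDeriv i
      (fun s : ℝ => height m₁ m₀ e G (adaptedMap m₁ m₀ e G u + s • e)) 0 = 0}

end Strata

/-! ### The spaces of continuous functions -/

/-- `C¹` of the circle. -/
def C1 : Type := {u : ℝ → ℝ // Function.Periodic u 1 ∧ ContDiff ℝ 1 u}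

instance : Nonempty C1 := ⟨⟨fun _ => 0, fun _ => rfl, contDiff_const⟩⟩

/-- `C⁰` of the circle. -/
def C0 : Submodule ℝ (ℝ → ℝ) where
  carrier := {v | Function.Periodic v 1 ∧ Continuous v}
  add_mem' := fun ha hb => ⟨ha.1.add hb.1, ha.2.add hb.2⟩
  zero_mem' := ⟨fun _ => rfl, continuous_const⟩
  smul_mem' := fun c _ hv => ⟨hv.1.smul c, hv.2.const_smul c⟩

def meanC1 (u : C1) : ℝ := ∫ t in (0 : ℝ)..1, u.1 t

def meanC0 (v : C0) : ℝ := ∫ t in (0 : ℝ)..1, v.1 t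

def oneC0 : C0 := ⟨fun _ => 1, fun _ => rfl, continuous_const⟩

lemma C1.periodic_deriv (u : C1) : Function.Periodic (deriv u.1) 1 := fun t => by
  rw [← deriv_comp_add_const, funext u.2.1]

/-- `F(u)(t) = u'(t) + f(u(t))` from `C¹` to `C⁰`. -/
def opC (f : ℝ → ℝ) (hf : ContDiff ℝ ∞ f) (u : C1) : C0 :=
  ⟨fun t => deriv u.1 t + f (u.1 t),
    fun t => by
      change deriv u.1 (t + 1) + f (u.1 (t + 1)) = deriv u.1 t + f (u.1 t)
      rw [u.periodic_deriv t, u.2.1 t],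
    (u.2.2.continuous_deriv le_rfl).add (hf.continuous.comp u.2.2.continuous)⟩

/-- The simplified operator, `F̂(u)(t) = u'(t) + ∫ f(u(s)) ds`, from `C¹` to `C⁰`. -/
def simpleOpC (f : ℝ → ℝ) (u : C1) : C0 :=
  ⟨fun t => deriv u.1 t + ∫ s in (0 : ℝ)..1, f (u.1 s),
    fun t => by
      change deriv u.1 (t + 1) + _ = deriv u.1 t + _
      rw [u.periodic_deriv t],
    (u.2.2.continuous_deriv le_rfl).add continuous_const⟩

/-- `S_k` in the `C` case. -/
def strataC (f : ℝ → ℝ) (hf : ContDiff ℝ ∞ f) (k : ℕ) : Set C1 :=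
  stratum meanC1 meanC0 oneC0 (opC f hf) k

/-- `Ŝ_k` in the `C` case. -/
def simpleStrataC (f : ℝ → ℝ) (k : ℕ) : Set C1 :=
  stratum meanC1 meanC0 oneC0 (simpleOpC f) k

/-! ### The Sobolev spaces -/

/-- Lebesgue measure on a period. -/
abbrev periodMeasure : Measure ℝ := volume.restrict (Ioc (0 : ℝ) 1)

/-- `H¹` of the circle: the periodic absolutely continuous functions with derivative in `L²`. -/
def H1 : Type :=
  {u : ℝ → ℝ // Function.Periodic u 1 ∧ (∀ a b : ℝ, AbsolutelyContinuousOnInterval u a b) ∧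
    MemLp (deriv u) 2 periodMeasure}

lemma H1.continuous (u : H1) : Continuous u.1 := by
  rw [continuous_iff_continuousAt]
  intro x
  have h := (u.2.2.1 (x - 1) (x + 1)).continuousOn
  rw [uIcc_of_le (by linarith)] at h
  exact h.continuousAt (Icc_mem_nhds (by linarith) (by linarith))

lemma memLp_of_continuous {g : ℝ → ℝ} (hg : Continuous g) : MemLp g 2 periodMeasure := by
  obtain ⟨C, hC⟩ := (isCompact_Icc (a := (0 : ℝ)) (b := 1)).exists_bound_of_continuousOn
    hg.continuousOn
  refine MemLp.of_bound hg.aestronglyMeasurable C ?_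
  filter_upwards [ae_restrict_mem measurableSet_Ioc] with x hx
  exact hC x (Ioc_subset_Icc_self hx)

instance : Nonempty H1 :=
  ⟨⟨fun _ => 0, fun _ => rfl,
    fun a b => by
      simpa using (LipschitzOnWith.of_dist_le_mul (K := 0) (s := uIcc a b)
        (f := fun _ : ℝ => (0 : ℝ)) (by simp)).absolutelyContinuousOnInterval,
    by simp⟩⟩

/-- `L²` of the circle. -/
abbrev H0 : Type := Lp ℝ 2 periodMeasure

def meanH1 (u : H1) : ℝ := ∫ t in (0 : ℝ)..1, u.1 t

def meanH0 (v : H0) : ℝ := ∫ t in (0 : ℝ)..1, v t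

def oneH0 : H0 := (memLp_of_continuous (continuous_const (y := (1 : ℝ)))).toLp _

/-- `F(u) = u' + f(u)` from `H¹` to `L²`. -/
def opH (f : ℝ → ℝ) (hf : ContDiff ℝ ∞ f) (u : H1) : H0 :=
  (u.2.2.2.add (memLp_of_continuous (hf.continuous.comp u.continuous))).toLp
    (fun t => deriv u.1 t + f (u.1 t))

/-- The simplified operator, `F̂(u) = u' + ∫ f(u(s)) ds`, from `H¹` to `L²`. -/
def simpleOpH (f : ℝ → ℝ) (u : H1) : H0 :=
  (u.2.2.2.add (memLp_of_continuous
      (continuous_const (y := ∫ s in (0 : ℝ)..1, f (u.1 s))))).toLp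
    (fun t => deriv u.1 t + ∫ s in (0 : ℝ)..1, f (u.1 s))

/-- `S_k` in the `H` case. -/
def strataH (f : ℝ → ℝ) (hf : ContDiff ℝ ∞ f) (k : ℕ) : Set H1 :=
  stratum meanH1 meanH0 oneH0 (opH f hf) k

/-- `Ŝ_k` in the `H` case. -/
def simpleStrataH (f : ℝ → ℝ) (k : ℕ) : Set H1 :=
  stratum meanH1 meanH0 oneH0 (simpleOpH f) k

/-! ### The curve `γ̂_k` and `k`-good functions -/

/-- `γ̂_k(x) = (f'(x), …, f^{(k)}(x))`. -/
def gammaHat (f : ℝ → ℝ) (k : ℕ) (x : ℝ) : Fin k → ℝ :=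
  fun i => iteratedDeriv (i.1 + 1) f x

/-- `γ̂_k` never vanishes, and it maps no nonempty open interval into a hyperplane through the
origin of `ℝᵏ`. -/
def IsGood (f : ℝ → ℝ) (k : ℕ) : Prop :=
  (∀ x, gammaHat f k x ≠ 0) ∧
    ∀ a b : ℝ, a < b → ∀ P : Submodule ℝ (Fin k → ℝ), Module.finrank ℝ P + 1 = k →
      ¬ gammaHat f k '' Ioo a b ⊆ P

end

end PeriodicODE

/-!
Both kinds of strata are described by equations along loops. If `U_s` solves
`G U_s = G u + β(s)` with mean `mean u + s`, then `u` lies in the `k`-th stratum of `G` exactly when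
the first `k` derivatives of `β` vanish at `0`. For `F̂` one can take `U_s = u + s`, so that `Ŝ_k`
consists of the loops with `∫ γ̂_k(u) = 0`.

If `∫ γ̂_k(u) = 0`, a functional which is nonpositive on the curve vanishes along `u`, hence on the
image of an open interval, and is zero because `f` is `k`-good; so `0` is in the interior of the
convex hull. Conversely, if `0` is interior, then a large sine loop `v` admits a positive weight `ρ`
of mean `1` with `∫ ρ γ̂_k(v) = 0`, and running through `v` with velocity `1 / ρ` gives an element
of `Ŝ_k`.

For `F`, run `n` times through `v`, with velocity `n / ρ`, to get a loop `u`. In the parameter of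
`v`, a solution `v + ζ` of `F U = F u + β` satisfies `ζ' = -ρ (f(v + ζ) - f(v) - β) / n`. When
`1 / n` is replaced by `0`, this leaves only `ζ = s` and `β(s) = ∫ ρ (f(v + s) - f(v))`, whose
`k`-jet is `∫ ρ γ̂_k(v)`. The map sending `ρ` to its mean and this moment is a linear surjection, so
for large `n` the implicit function theorem yields a weight close to `ρ` for which the jet of `β`
vanishes.
-/

namespace PeriodicODE

open Filter Topology

section Convexity

lemma convexHull_iUnion_of_monotone {V : Type*} [AddCommGroup V] [Module ℝ V]
    {S : ℕ → Set V} (hS : Monotone S) :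
    convexHull ℝ (⋃ n, S n) = ⋃ n, convexHull ℝ (S n) :=
  have hmono : Monotone fun n => convexHull ℝ (S n) := (convexHull ℝ).monotone.comp hS
  subset_antisymm
    (convexHull_min (iUnion_mono fun _ => subset_convexHull ℝ _)
      (hmono.directed_le.convex_iUnion fun _ => convex_convexHull ℝ _))
    (iUnion_subset fun n => convexHull_mono (subset_iUnion S n))

variable {E : Type*} [NormedAddCommGroup E] [NormedSpace ℝ E] [FiniteDimensional ℝ E]

lemma exists_dual_ne_zero_of_interior_eq_empty {s : Set E} (hs : Convex ℝ s) (hne : s.Nonempty)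
    (hint : interior s = ∅) : ∃ g : E →L[ℝ] ℝ, g ≠ 0 ∧ ∀ y ∈ s, ∀ z ∈ s, g y = g z := by
  have hspan : vectorSpan ℝ s ≠ ⊤ := by
    rw [Ne, ← AffineSubspace.affineSpan_eq_top_iff_vectorSpan_eq_top_of_nonempty ℝ E E hne,
      ← hs.interior_nonempty_iff_affineSpan_eq_top, hint]
    exact not_nonempty_empty
  obtain ⟨g, hg, hker⟩ := Submodule.exists_le_ker_of_lt_top _ hspan.lt_top
  refine ⟨g.toContinuousLinearMap, by simpa using hg, fun y hy z hz => sub_eq_zero.1 ?_⟩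
  rw [← map_sub]
  exact hker (vsub_mem_vectorSpan ℝ hy hz)

lemma mem_interior_iff_forall_dual_eq_zero {s : Set E} (hs : Convex ℝ s) (hne : s.Nonempty)
    {x : E} : x ∈ interior s ↔ ∀ g : E →L[ℝ] ℝ, (∀ y ∈ s, g y ≤ g x) → g = 0 := by
  refine ⟨fun hx g hg => ?_, fun h => ?_⟩
  · have hmax : IsLocalMax g x := by
      filter_upwards [mem_interior_iff_mem_nhds.1 hx] using hg
    exact hmax.hasFDerivAt_eq_zero g.hasFDerivAt
  by_contra hx
  rcases (interior s).eq_empty_or_nonempty with hint | hint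
  · obtain ⟨g, hg, hconst⟩ := exists_dual_ne_zero_of_interior_eq_empty hs hne hint
    obtain ⟨z, hz⟩ := hne
    rcases le_total (g z) (g x) with hzx | hzx
    · exact hg (h g fun y hy => (hconst y hy z hz).trans_le hzx)
    · refine hg (neg_eq_zero.1 (h (-g) fun y hy => ?_))
      simpa only [neg_apply, neg_le_neg_iff, hconst y hy z hz] using hzx
  · obtain ⟨g, hg⟩ := geometric_hahn_banach_open_point hs.interior isOpen_interior hx
    obtain ⟨z, hz⟩ := hint
    have hle : closure (interior s) ⊆ {y | g y ≤ g x} :=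
      closure_minimal (fun y hy => (hg y hy).le) (isClosed_le g.continuous continuous_const)
    rw [hs.closure_interior_eq_closure_of_nonempty_interior ⟨z, hz⟩] at hle
    exact (hg z hz).ne (by rw [h g fun y hy => hle (subset_closure hy)]; rfl)

lemma zero_mem_interior_convexHull_iff {s : Set E} (hne : s.Nonempty) :
    (0 : E) ∈ interior (convexHull ℝ s) ↔ ∀ g : E →L[ℝ] ℝ, (∀ y ∈ s, g y ≤ 0) → g = 0 := by
  rw [mem_interior_iff_forall_dual_eq_zero (convex_convexHull ℝ s) hne.convexHull]
  refine forall_congr' fun g => imp_congr_left ⟨fun h y hy => ?_, fun h y hy => ?_⟩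
  · simpa only [map_zero] using h y (subset_convexHull ℝ s hy)
  · rw [map_zero]
    exact convexHull_min h (convex_halfSpace_le g.isLinear 0) hy

lemma dual_eq_zero_of_forall_apply_one_prod {s : Set E} (h0 : (0 : E) ∈ interior (convexHull ℝ s))
    {g : ℝ × E →L[ℝ] ℝ} (hg : ∀ y ∈ s, g (1, y) = 0) : g = 0 := by
  have hsplit (a : ℝ) (y : E) : g (a, y) = a * g (1, 0) + g (0, y) := by
    rw [← smul_eq_mul, ← map_smul, ← map_add]
    simp
  have hconv : Convex ℝ {y | g (0, y) = -g (1, 0)} :=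
    (convex_singleton (-g (1, 0))).linear_preimage (g.comp (.inr ℝ ℝ E)).toLinearMap
  have hs : s ⊆ {y | g (0, y) = -g (1, 0)} := fun y hy => by
    have h := hg y hy
    rw [hsplit, one_mul] at h
    exact eq_neg_of_add_eq_zero_right h
  have hone : g (1, 0) = 0 := by
    have h : g (0, 0) = -g (1, 0) := convexHull_min hs hconv (interior_subset h0)
    rw [Prod.mk_zero_zero, map_zero] at h
    exact neg_eq_zero.1 h.symm
  have hinr : g.comp (.inr ℝ ℝ E) = 0 := by
    refine (zero_mem_interior_convexHull_iff (convexHull_nonempty_iff.1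
      ⟨0, interior_subset h0⟩)).1 h0 _ fun y hy => ?_
    exact ((hs hy).trans (by rw [hone, neg_zero])).le
  ext y
  · exact hone
  · exact DFunLike.congr_fun hinr y

lemma exists_mem_interior_convexHull_of_iUnion {S : ℕ → Set E} (hS : Monotone S) {x : E}
    (hx : x ∈ interior (convexHull ℝ (⋃ n, S n))) : ∃ n, x ∈ interior (convexHull ℝ (S n)) := by
  rw [convexHull_iUnion_of_monotone hS, mem_interior_iff_mem_nhds] at hx
  obtain ⟨b, hxb, hb⟩ := exists_mem_interior_convexHull_affineBasis hx
  choose N hN using fun i => mem_iUnion.1 (hb (subset_convexHull ℝ _ (mem_range_self i)))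
  refine ⟨Finset.univ.sup N, interior_mono (convexHull_min ?_ (convex_convexHull ℝ _)) hxb⟩
  rintro _ ⟨i, rfl⟩
  exact convexHull_mono (hS (Finset.le_sup (Finset.mem_univ i))) (hN i)

end Convexity

section Moments

variable {X E : Type*} [TopologicalSpace X] [CompactSpace X] [MeasurableSpace X] [BorelSpace X]
  [NormedAddCommGroup E] (μ : Measure X) [IsFiniteMeasure μ]

lemma integrable_continuousMap (c : C(X, E)) : Integrable c μ :=
  c.continuous.integrable_of_hasCompactSupport (HasCompactSupport.of_compactSpace c)

variable [NormedSpace ℝ E]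

/-- The moment `∫ ρ c` of a continuous vector-valued function `c` against the weight `ρ`, as an
operator on weights. -/
noncomputable def moment (c : C(X, E)) : C(X, ℝ) →L[ℝ] E :=
  LinearMap.mkContinuous
    { toFun := fun ρ => ∫ x, ρ x • c x ∂μ
      map_add' := fun ρ σ => by
        simp only [ContinuousMap.add_apply, add_smul]
        exact integral_add (integrable_continuousMap μ (ρ • c)) (integrable_continuousMap μ (σ • c))
      map_smul' := fun a ρ => by
        simp only [ContinuousMap.smul_apply, smul_assoc, RingHom.id_apply, integral_smul] }
    (∫ x, ‖c x‖ ∂μ) fun ρ => by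
      rw [mul_comm, ← integral_const_mul]
      refine norm_integral_le_of_norm_le ((integrable_continuousMap μ c).norm.const_mul _)
        (ae_of_all μ fun x => ?_)
      rw [norm_smul]
      exact mul_le_mul_of_nonneg_right (ρ.norm_coe_le_norm x) (norm_nonneg _)

/-- The integral over `X` of a continuous function, as an operator. -/
noncomputable abbrev mean : C(X, ℝ) →L[ℝ] ℝ := moment μ 1

lemma moment_apply (c : C(X, E)) (ρ : C(X, ℝ)) : moment μ c ρ = ∫ x, ρ x • c x ∂μ := rfl

lemma mean_apply (ρ : C(X, ℝ)) : mean μ ρ = ∫ x, ρ x ∂μ := by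
  simp only [moment_apply, ContinuousMap.one_apply, smul_eq_mul, mul_one]

lemma moment_prodMk {F : Type*} [NormedAddCommGroup F] [NormedSpace ℝ F] [CompleteSpace E]
    [CompleteSpace F] (c : C(X, E)) (d : C(X, F)) :
    moment μ (c.prodMk d) = (moment μ c).prod (moment μ d) := by
  ext ρ
  · exact fst_integral (integrable_continuousMap μ (ρ • c.prodMk d))
  · exact snd_integral (integrable_continuousMap μ (ρ • c.prodMk d))

lemma dual_moment [CompleteSpace E] (g : E →L[ℝ] ℝ) (c : C(X, E)) (ρ : C(X, ℝ)) :
    g (moment μ c ρ) = ∫ x, ρ x * g (c x) ∂μ := by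
  refine (g.integral_comp_comm (integrable_continuousMap μ (ρ • c))).symm.trans ?_
  simp only [ContinuousMap.smul_apply', map_smul, smul_eq_mul]

variable [μ.IsOpenPosMeasure]

lemma eq_zero_of_integral_mul_self_nonpos {h : C(X, ℝ)} (hh : ∫ x, h x * h x ∂μ ≤ 0) : h = 0 := by
  have hae : (fun x => h x * h x) =ᵐ[μ] fun _ => 0 :=
    (integral_eq_zero_iff_of_nonneg (fun x => mul_self_nonneg (h x))
      (integrable_continuousMap μ (h * h))).1
      (hh.antisymm (integral_nonneg fun x => mul_self_nonneg (h x)))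
  have hsq := Measure.eq_of_ae_eq hae (h.continuous.mul h.continuous) continuous_const
  exact ContinuousMap.ext fun x => mul_self_eq_zero.1 (congr_fun hsq x)

lemma nonpos_of_forall_integral_mul_nonpos {h : C(X, ℝ)}
    (H : ∀ ρ : C(X, ℝ), (∀ x, 0 < ρ x) → ∫ x, ρ x * h x ∂μ ≤ 0) (x : X) : h x ≤ 0 := by
  have hpos : ∫ x, (h ⊔ 0) x * h x ∂μ ≤ 0 := by
    have hcont : Continuous fun ε : ℝ => moment μ h (h ⊔ 0 + ε • 1) := by fun_prop
    have hlim := (hcont.tendsto 0).mono_left (nhdsWithin_le_nhds (s := Ioi 0))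
    rw [zero_smul, add_zero] at hlim
    refine le_of_tendsto hlim ?_
    filter_upwards [self_mem_nhdsWithin] with ε (hε : 0 < ε)
    refine H _ fun x => ?_
    simpa using add_pos_of_nonneg_of_pos (le_max_right (h x) 0) hε
  have hsq : ∀ x, (h ⊔ 0) x * h x = (h ⊔ 0) x * (h ⊔ 0) x := fun x => by
    rcases le_total (h x) 0 with hx | hx <;> simp [hx]
  simp only [hsq] at hpos
  simpa using DFunLike.congr_fun (eq_zero_of_integral_mul_self_nonpos μ hpos) x

variable [FiniteDimensional ℝ E]

lemma moment_surjective {c : C(X, E)} (hc : ∀ g : E →L[ℝ] ℝ, (∀ x, g (c x) = 0) → g = 0) :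
    Function.Surjective (moment μ c) := by
  by_contra hns
  obtain ⟨g, hg, hker⟩ := Submodule.exists_le_ker_of_lt_top (moment μ c).range
    (lt_top_iff_ne_top.2 fun h => hns (LinearMap.range_eq_top.1 h))
  let gc : C(X, ℝ) := ⟨fun x => g (c x), g.continuous_of_finiteDimensional.comp c.continuous⟩
  have hsq : ∫ x, gc x * gc x ∂μ = 0 :=
    (dual_moment μ g.toContinuousLinearMap c gc).symm.trans (hker ⟨gc, rfl⟩)
  have hgc := eq_zero_of_integral_mul_self_nonpos μ hsq.le
  exact hg (by simpa using hc g.toContinuousLinearMap (DFunLike.congr_fun hgc))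

lemma exists_pos_moment_eq_zero {c : C(X, E)} (hc : (0 : E) ∈ interior (convexHull ℝ (range c))) :
    ∃ ρ : C(X, ℝ), (∀ x, 0 < ρ x) ∧ moment μ c ρ = 0 := by
  have hconv : Convex ℝ {ρ : C(X, ℝ) | ∀ x, 0 < ρ x} := fun ρ hρ σ hσ a b ha hb hab x =>
    convex_Ioi (0 : ℝ) (hρ x) (hσ x) ha hb hab
  have hne : (range c).Nonempty := convexHull_nonempty_iff.1 ⟨0, interior_subset hc⟩
  have himage : (0 : E) ∈ interior (moment μ c '' {ρ | ∀ x, 0 < ρ x}) := by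
    refine (mem_interior_iff_forall_dual_eq_zero (hconv.linear_image (moment μ c).toLinearMap)
      ⟨_, 1, fun _ => one_pos, rfl⟩).2 fun g hg => ?_
    refine (zero_mem_interior_convexHull_iff hne).1 hc g (forall_mem_range.2 ?_)
    refine nonpos_of_forall_integral_mul_nonpos μ (h := ⟨fun x => g (c x), by fun_prop⟩)
      fun ρ hρ => ?_
    rw [← map_zero g]
    exact (dual_moment μ g c ρ).symm.trans_le (hg _ ⟨ρ, hρ, rfl⟩)
  obtain ⟨ρ, hρ, h0⟩ := interior_subset himage
  exact ⟨ρ, hρ, h0⟩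

lemma exists_pos_mean_eq_one_moment_eq_zero [NeZero μ] {c : C(X, E)}
    (hc : (0 : E) ∈ interior (convexHull ℝ (range c))) :
    ∃ ρ : C(X, ℝ), (∀ x, 0 < ρ x) ∧ mean μ ρ = 1 ∧ moment μ c ρ = 0 := by
  obtain ⟨ρ, hρ, h0⟩ := exists_pos_moment_eq_zero μ hc
  have hmean : 0 < mean μ ρ := by
    rw [mean_apply]
    refine (integral_pos_iff_support_of_nonneg (fun x => (hρ x).le)
      (integrable_continuousMap μ ρ)).2 ?_
    rw [Function.support_eq_univ fun x => (hρ x).ne']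
    exact Measure.measure_univ_pos.2 (NeZero.ne μ)
  refine ⟨(mean μ ρ)⁻¹ • ρ, fun x => mul_pos (inv_pos.2 hmean) (hρ x), ?_, ?_⟩
  · rw [map_smul, smul_eq_mul, inv_mul_cancel₀ hmean.ne']
  · rw [map_smul, h0, smul_zero]

end Moments

section MeanSlope

/-- The average of `f'` over the segment from `p.1` to `p.2`: a difference quotient of `f` which
is continuous across the diagonal. -/
noncomputable def meanSlope (f : ℝ → ℝ) (p : ℝ × ℝ) : ℝ :=
  ∫ σ in (0 : ℝ)..1, deriv f (p.1 + σ * (p.2 - p.1))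

lemma meanSlope_self (f : ℝ → ℝ) (x : ℝ) : meanSlope f (x, x) = deriv f x := by
  simp only [meanSlope, sub_self, mul_zero, add_zero, intervalIntegral.integral_const, sub_zero,
    one_smul]

lemma continuous_meanSlope {f : ℝ → ℝ} (hf : ContDiff ℝ 1 f) : Continuous (meanSlope f) := by
  have hderiv : Continuous fun q : (ℝ × ℝ) × ℝ => deriv f (q.1.1 + q.2 * (q.1.2 - q.1.1)) :=
    (hf.continuous_deriv le_rfl).comp (by fun_prop)
  exact intervalIntegral.continuous_parametric_intervalIntegral_of_continuous' hderiv 0 1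

lemma meanSlope_mul_sub {f : ℝ → ℝ} (hf : ContDiff ℝ 1 f) (x y : ℝ) :
    meanSlope f (x, y) * (y - x) = f y - f x := by
  have h := intervalIntegral.mul_integral_comp_add_mul (f := deriv f) (a := 0) (b := 1) (y - x) x
  simp only [mul_zero, add_zero, mul_one, add_sub_cancel] at h
  rw [mul_comm, meanSlope, ← intervalIntegral.integral_deriv_eq_sub
    (fun z _ => (hf.differentiable one_ne_zero).differentiableAt)
    ((hf.continuous_deriv le_rfl).intervalIntegrable x y), ← h]
  simp only [mul_comm]

end MeanSlope

section Composition

lemma hasFDerivAt_mul_of_slope {A : Type*} [NormedCommRing A] [NormedAlgebra ℝ A] {F S : A → A}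
    {u : A} (hS : ContinuousAt S u) (hF : ∀ v, F v - F u = S v * (v - u)) :
    HasFDerivAt F (ContinuousLinearMap.mul ℝ A (S u)) u := by
  have hlim : Tendsto (fun v => S v - S u) (𝓝 u) (𝓝 0) := by
    simpa only [sub_self] using hS.tendsto.sub_const (S u)
  have hrem : (fun v => F v - F u - ContinuousLinearMap.mul ℝ A (S u) (v - u)) =
      fun v => (S v - S u) * (v - u) := by
    ext v
    rw [hF, ContinuousLinearMap.mul_apply', sub_mul]
  refine .of_isLittleO (hrem ▸ Asymptotics.IsLittleO.of_norm_right ?_)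
  simpa only [one_mul] using ((Asymptotics.isLittleO_one_iff ℝ).2 hlim).mul_isBigO
    (Asymptotics.isBigO_refl (fun v => v - u) (𝓝 u)).norm_right

variable {X : Type*} [TopologicalSpace X] [CompactSpace X]

lemma hasFDerivAt_comp {f f' : C(ℝ, ℝ)} (hf : ∀ x, HasDerivAt f (f' x) x) (u : C(X, ℝ)) :
    HasFDerivAt (fun v : C(X, ℝ) => f.comp v)
      (ContinuousLinearMap.mul ℝ C(X, ℝ) (f'.comp u)) u := by
  have hderiv : deriv f = f' := funext fun x => (hf x).deriv
  have hf1 : ContDiff ℝ 1 f := contDiff_one_iff_deriv.2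
    ⟨fun x => (hf x).differentiableAt, hderiv ▸ f'.continuous⟩
  let Q : C(ℝ × ℝ, ℝ) := ⟨meanSlope f, continuous_meanSlope hf1⟩
  have hQ : f'.comp u = Q.comp (u.prodMk u) := by
    ext x
    exact (congr_fun hderiv (u x)).symm.trans (meanSlope_self f (u x)).symm
  rw [hQ]
  refine hasFDerivAt_mul_of_slope (S := fun v => Q.comp (u.prodMk v)) ?_ fun v => ?_
  · refine (ContinuousMap.continuous_of_continuous_uncurry _ ?_).continuousAt
    exact Q.continuous.comp ((u.continuous.comp continuous_snd).prodMk continuous_eval)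
  · ext x
    exact (meanSlope_mul_sub hf1 (u x) (v x)).symm

lemma contDiff_comp {n : ℕ} {f : C(ℝ, ℝ)} (hf : ContDiff ℝ n f) :
    ContDiff ℝ n fun u : C(X, ℝ) => f.comp u := by
  induction n generalizing f with
  | zero => exact contDiff_zero.2 (ContinuousMap.continuous_postcomp f)
  | succ n ih =>
    have hf' : ContDiff ℝ n (deriv f) := ((contDiff_succ_iff_deriv (n := n)).1 hf).2.2
    let f' : C(ℝ, ℝ) := ⟨deriv f, hf'.continuous⟩
    have hderiv (x : ℝ) : HasDerivAt f (f' x) x :=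
      (hf.differentiable (by simp) x).hasDerivAt
    exact contDiff_succ_iff_hasFDerivAt.2 ⟨_,
      (ContinuousLinearMap.mul ℝ C(X, ℝ)).contDiff.comp (ih (f := f') hf'),
      hasFDerivAt_comp hderiv⟩

/-- The increment `ρ (f(v + z) - f(v))`, as a function of the weight `ρ` and the displacement
`z`. -/
noncomputable def increment (f : C(ℝ, ℝ)) (v : C(X, ℝ)) (p : C(X, ℝ) × C(X, ℝ)) : C(X, ℝ) :=
  p.1 * (f.comp (v + p.2) - f.comp v)

lemma contDiff_increment {f : C(ℝ, ℝ)} {n : ℕ} (hf : ContDiff ℝ n f) (v : C(X, ℝ)) :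
    ContDiff ℝ n (increment f v) := by
  have hcomp : ContDiff ℝ n fun p : C(X, ℝ) × C(X, ℝ) => f.comp (v + p.2) :=
    (contDiff_comp hf).comp (by fun_prop)
  unfold increment
  fun_prop

end Composition

section Jets

lemma gammaHat_const_add (c : ℝ) (β : ℝ → ℝ) (k : ℕ) :
    gammaHat (fun s => c + β s) k = gammaHat β k := by
  ext x i
  exact iteratedDeriv_const_add i.1.succ_pos c

lemma gammaHat_congr {β β' : ℝ → ℝ} {x : ℝ} (h : β =ᶠ[𝓝 x] β') (k : ℕ) :
    gammaHat β k x = gammaHat β' k x :=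
  funext fun i => h.iteratedDeriv_eq (i.1 + 1)

lemma continuous_gammaHat {f : ℝ → ℝ} {k : ℕ} (hf : ContDiff ℝ k f) : Continuous (gammaHat f k) :=
  continuous_pi fun i => hf.continuous_iteratedDeriv _ (by exact_mod_cast i.2)

variable {Q : Type*} [NormedAddCommGroup Q] [NormedSpace ℝ Q] {b : ℝ × Q → ℝ} {p : ℝ × Q}

lemma contDiffAt_deriv_fst {n : ℕ} (hb : ContDiffAt ℝ (n + 1 : ℕ) b p) :
    ContDiffAt ℝ n (fun p : ℝ × Q => deriv (fun s => b (s, p.2)) p.1) p := by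
  have hfderiv : ContDiffAt ℝ n (fun p : ℝ × Q => fderiv ℝ b p (1, 0)) p :=
    (hb.fderiv_right (by exact_mod_cast le_rfl)).clm_apply contDiffAt_const
  refine hfderiv.congr_of_eventuallyEq ?_
  filter_upwards [hb.eventually (by exact_mod_cast ENat.natCast_ne_top (n + 1))] with p hp
  have hslice : HasDerivAt (fun s : ℝ => (s, p.2)) ((1 : ℝ), (0 : Q)) p.1 :=
    (hasDerivAt_id p.1).prodMk (hasDerivAt_const _ _)
  exact ((hp.differentiableAt (by simp)).hasFDerivAt.comp_hasDerivAt p.1 hslice).deriv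

lemma contDiffAt_iteratedDeriv_fst {n i : ℕ} (hb : ContDiffAt ℝ (n + i : ℕ) b p) :
    ContDiffAt ℝ n (fun p : ℝ × Q => iteratedDeriv i (fun s => b (s, p.2)) p.1) p := by
  induction i generalizing b with
  | zero => simpa using hb
  | succ i ih =>
    simp only [iteratedDeriv_succ']
    exact ih (contDiffAt_deriv_fst hb)

lemma contDiffAt_gammaHat_fst {n k : ℕ} {s : ℝ} {q : Q}
    (hb : ContDiffAt ℝ (n + k : ℕ) b (s, q)) :
    ContDiffAt ℝ n (fun q : Q => gammaHat (fun s => b (s, q)) k s) q :=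
  contDiffAt_pi.2 fun i => (contDiffAt_iteratedDeriv_fst (i := i.1 + 1)
    (hb.of_le (by exact_mod_cast Nat.add_le_add_left i.2 n))).comp q
      (contDiffAt_const.prodMk contDiffAt_id)

end Jets

section FlatFamilies

variable {Q Z F : Type*} [NormedAddCommGroup Q] [NormedSpace ℝ Q] [CompleteSpace Q]
  [NormedAddCommGroup Z] [NormedSpace ℝ Z] [CompleteSpace Z]
  [NormedAddCommGroup F] [NormedSpace ℝ F] [CompleteSpace F]

lemma eventually_exists_eq_of_surjective {A : Type*} [NormedAddCommGroup A] [NormedSpace ℝ A]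
    [CompleteSpace A] {G : A × Q → F} {G' : A × Q →L[ℝ] F} {a₀ : A} {q₀ : Q}
    (hG : HasStrictFDerivAt G G' (a₀, q₀))
    (hsurj : Function.Surjective (G' ∘L .inr ℝ A Q)) {U : Set Q} (hU : U ∈ 𝓝 q₀) :
    ∀ᶠ a in 𝓝 a₀, ∃ q ∈ U, G (a, q) = G (a₀, q₀) := by
  have hgraph : HasStrictFDerivAt (fun p : A × Q => (p.1, G p))
      ((ContinuousLinearMap.fst ℝ A Q).prod G') (a₀, q₀) := hasStrictFDerivAt_fst.prodMk hG
  have hgraph_surj : ((ContinuousLinearMap.fst ℝ A Q).prod G').range = ⊤ := by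
    refine LinearMap.range_eq_top.2 fun ⟨a, y⟩ => ?_
    obtain ⟨q, hq⟩ := hsurj (y - G' (a, 0))
    refine ⟨(a, q), Prod.ext rfl ?_⟩
    calc G' (a, q) = G' (a, 0) + G' (0, q) := by rw [← map_add]; simp
      _ = y := by rw [show G' (0, q) = _ from hq, add_sub_cancel]
  have himage : (fun p : A × Q => (p.1, G p)) '' (univ ×ˢ U) ∈ 𝓝 (a₀, G (a₀, q₀)) := by
    rw [← hgraph.map_nhds_eq_of_surj hgraph_surj]
    exact image_mem_map (prod_mem_nhds univ_mem hU)
  filter_upwards [(Continuous.prodMk_left (G (a₀, q₀))).tendsto a₀ himage]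
  rintro a ⟨⟨a, q⟩, ⟨-, hq⟩, heq⟩
  obtain ⟨rfl, hG⟩ := Prod.mk.inj heq
  exact ⟨q, hq, hG⟩

lemma exists_contDiffAt_solution {n : ℕ} (hn : n ≠ 0) {T : Q × Z → Z} (hT : ContDiff ℝ n T)
    (e : Z) (q₀ : Q) :
    ∃ ζ : ℝ × ℝ × Q → Z, ContDiffAt ℝ n ζ (0, 0, q₀) ∧
      ∀ᶠ p in 𝓝 (0, 0, q₀), ζ p = p.1 • e + p.2.1 • T (p.2.2, ζ p) := by
  let Φ : (ℝ × ℝ × Q) × Z → Z := fun p => p.2 - (p.1.1 • e + p.1.2.1 • T (p.1.2.2, p.2))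
  have hΦ : ContDiffAt ℝ n Φ ((0, 0, q₀), 0) := by fun_prop
  have hΦ0 (z : Z) : Φ ((0, 0, q₀), z) = z := by simp [Φ]
  have hn' : (n : WithTop ℕ∞) ≠ 0 := by exact_mod_cast hn
  have hpartial : fderiv ℝ Φ ((0, 0, q₀), 0) ∘L .inr ℝ (ℝ × ℝ × Q) Z = .id ℝ Z := by
    have hcomp := (hΦ.differentiableAt hn').hasFDerivAt.comp (0 : Z)
      (hasFDerivAt_prodMk_right (𝕜 := ℝ) ((0 : ℝ), (0 : ℝ), q₀) (0 : Z))
    exact hcomp.unique ((hasFDerivAt_id _).congr_of_eventuallyEq (.of_forall hΦ0))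
  have hinv : (fderiv ℝ Φ ((0, 0, q₀), 0) ∘L .inr ℝ (ℝ × ℝ × Q) Z).IsInvertible :=
    hpartial ▸ ⟨.refl ℝ Z, rfl⟩
  refine ⟨hΦ.implicitFunction hn' hinv, hΦ.contDiffAt_implicitFunction hn' hinv, ?_⟩
  filter_upwards [hΦ.eventually_apply_implicitFunction hn' hinv] with p hp
  exact sub_eq_zero.1 (hp.trans (hΦ0 0))

lemma eventually_exists_flat_solution {k : ℕ} {T : Q × Z → Z} {B : Q × Z → ℝ}
    (hT : ContDiff ℝ (1 + k : ℕ) T) (hB : ContDiff ℝ (1 + k : ℕ) B) (e : Z)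
    {M : Q →L[ℝ] (Fin k → ℝ)} (hM : ∀ q, gammaHat (fun s => B (q, s • e)) k 0 = M q)
    (N : Q →L[ℝ] F) (hsurj : Function.Surjective (N.prod M)) {q₀ : Q} (hq₀ : M q₀ = 0)
    {U : Set Q} (hU : U ∈ 𝓝 q₀) :
    ∀ᶠ ε in 𝓝 (0 : ℝ), ∃ q ∈ U, N q = N q₀ ∧ ∃ ζ : ℝ → Z,
      (∀ᶠ s in 𝓝 0, ζ s = s • e + ε • T (q, ζ s)) ∧
        gammaHat (fun s => B (q, ζ s)) k 0 = 0 := by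
  obtain ⟨ζ, hζ, hsol⟩ := exists_contDiffAt_solution (by lia) hT e q₀
  have hsol' : ∀ᶠ a in 𝓝 ((0 : ℝ), q₀), ∀ᶠ s in 𝓝 (0 : ℝ),
      ζ (s, a) = s • e + a.1 • T (a.2, ζ (s, a)) := by
    rw [nhds_prod_eq] at hsol
    exact (eventually_swap_iff.1 hsol).curry
  let J : ℝ × Q → Fin k → ℝ := fun a => gammaHat (fun s => B (a.2, ζ (s, a))) k 0
  have hJ : ContDiffAt ℝ 1 J (0, q₀) := by
    refine contDiffAt_gammaHat_fst (n := 1) (b := fun p => B (p.2.2, ζ p)) ?_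
    exact hB.contDiffAt.comp _ (by fun_prop)
  have hslice : Tendsto (fun q : Q => ((0 : ℝ), q)) (𝓝 q₀) (𝓝 (0, q₀)) :=
    (Continuous.prodMk_right 0).tendsto q₀
  have hJ0 : ∀ᶠ q in 𝓝 q₀, J (0, q) = M q := by
    filter_upwards [hslice.eventually hsol'] with q hq
    refine (gammaHat_congr (hq.mono fun s hs => ?_) k).trans (hM q)
    exact congrArg (fun z => B (q, z)) (hs.trans (by simp only [zero_smul, add_zero]))
  obtain ⟨J', hJ'⟩ : ∃ J', HasStrictFDerivAt J J' (0, q₀) := ⟨_, hJ.hasStrictFDerivAt one_ne_zero⟩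
  have hpartial : J' ∘L .inr ℝ ℝ Q = M :=
    (hJ'.hasFDerivAt.comp q₀ (hasFDerivAt_prodMk_right 0 q₀)).unique
      (M.hasFDerivAt.congr_of_eventuallyEq hJ0)
  have hG : HasStrictFDerivAt (fun a : ℝ × Q => (N a.2, J a))
      ((N ∘L .snd ℝ ℝ Q).prod J') (0, q₀) :=
    (N ∘L .snd ℝ ℝ Q).hasStrictFDerivAt.prodMk hJ'
  have hGsurj : Function.Surjective ((N ∘L .snd ℝ ℝ Q).prod J' ∘L .inr ℝ ℝ Q) := by
    rw [← hpartial] at hsurj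
    exact hsurj
  obtain ⟨V, hV, W, hW, hVW⟩ := mem_nhds_prod_iff.1 hsol'
  filter_upwards [eventually_exists_eq_of_surjective hG hGsurj (inter_mem hU hW), hV]
  rintro ε ⟨q, ⟨hqU, hqW⟩, hq⟩ hε
  obtain ⟨hNq, hJq⟩ := Prod.mk.inj hq
  exact ⟨q, hqU, hNq, fun s => ζ (s, ε, q), hVW (mk_mem_prod hε hqW),
    hJq.trans (hJ0.self_of_nhds.trans hq₀)⟩

end FlatFamilies

section FlatPerturbation

variable {X : Type*} [TopologicalSpace X] [CompactSpace X] [MeasurableSpace X] [BorelSpace X]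
  (μ : Measure X) [IsFiniteMeasure μ]

lemma deriv_mean_mul_comp_add {f : ℝ → ℝ} (hf : ContDiff ℝ 1 f) (ρ v : C(X, ℝ)) (s : ℝ) :
    deriv (fun s => ∫ x, ρ x * f (v x + s) ∂μ) s = ∫ x, ρ x * deriv f (v x + s) ∂μ := by
  let fc : C(ℝ, ℝ) := ⟨f, hf.continuous⟩
  let fc' : C(ℝ, ℝ) := ⟨deriv f, hf.continuous_deriv le_rfl⟩
  have hcomp := hasFDerivAt_comp (f := fc) (f' := fc')
    (fun x => (hf.differentiable one_ne_zero x).hasDerivAt) (v + s • 1)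
  have hline : HasDerivAt (fun s : ℝ => v + s • (1 : C(X, ℝ))) 1 s := by
    have h := ((hasDerivAt_id s).smul_const (1 : C(X, ℝ))).const_add v
    rwa [one_smul] at h
  have hderiv := (mean μ ∘L ContinuousLinearMap.mul ℝ C(X, ℝ) ρ).hasFDerivAt.comp_hasDerivAt s
    (hcomp.comp_hasDerivAt s hline)
  simpa [mean_apply, fc, fc', Function.comp_def] using hderiv.deriv

lemma iteratedDeriv_mean_mul_comp_add {f : ℝ → ℝ} {i : ℕ} (hf : ContDiff ℝ i f) (ρ v : C(X, ℝ))
    (s : ℝ) : iteratedDeriv i (fun s => ∫ x, ρ x * f (v x + s) ∂μ) s =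
      ∫ x, ρ x * iteratedDeriv i f (v x + s) ∂μ := by
  induction i generalizing f with
  | zero => simp only [iteratedDeriv_zero]
  | succ i ih =>
    rw [iteratedDeriv_succ', iteratedDeriv_succ',
      funext (deriv_mean_mul_comp_add μ (hf.of_le (by simp)) ρ v)]
    exact ih ((contDiff_succ_iff_deriv (n := i)).1 hf).2.2

/-- `γ̂_k` of a smooth function as a bundled continuous map. -/
noncomputable def gammaHatMap {f : ℝ → ℝ} (hf : ContDiff ℝ ∞ f) (k : ℕ) : C(ℝ, Fin k → ℝ) :=
  ⟨gammaHat f k, continuous_gammaHat (hf.of_le (by exact_mod_cast le_top))⟩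

lemma gammaHat_mean_mul_comp_add {f : ℝ → ℝ} (hf : ContDiff ℝ ∞ f) (k : ℕ) (ρ v : C(X, ℝ)) :
    gammaHat (fun s => ∫ x, ρ x * f (v x + s) ∂μ) k 0 =
      moment μ ((gammaHatMap hf k).comp v) ρ := by
  ext i
  rw [moment_apply, eval_integral fun i => ?_]
  · refine (iteratedDeriv_mean_mul_comp_add μ (hf.of_le ?_) ρ v 0).trans ?_
    · exact_mod_cast le_top
    · simp only [add_zero]
      rfl
  · exact (integrable_continuousMap μ (ρ • (gammaHatMap hf k).comp v)).eval i

lemma gammaHat_mean_increment {f : C(ℝ, ℝ)} (hf : ContDiff ℝ ∞ f) (k : ℕ) (ρ v : C(X, ℝ)) :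
    gammaHat (fun s => mean μ (increment f v (ρ, s • 1))) k 0 =
      moment μ ((gammaHatMap hf k).comp v) ρ := by
  have hexpand : (fun s : ℝ => mean μ (increment f v (ρ, s • 1))) =
      fun s => -mean μ (ρ * f.comp v) + ∫ x, ρ x * f (v x + s) ∂μ := by
    ext s
    simp only [increment, mul_sub, map_sub, neg_add_eq_sub]
    simp [mean_apply]
  rw [hexpand, gammaHat_const_add, gammaHat_mean_mul_comp_add μ hf]

variable [μ.IsOpenPosMeasure]

lemma mean_moment_surjective {E : Type*} [NormedAddCommGroup E] [NormedSpace ℝ E]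
    [FiniteDimensional ℝ E] {c : C(X, E)} (hc : (0 : E) ∈ interior (convexHull ℝ (range c))) :
    Function.Surjective ((mean μ).prod (moment μ c)) := by
  have : CompleteSpace E := FiniteDimensional.complete ℝ E
  rw [← moment_prodMk]
  refine moment_surjective μ fun g hg => ?_
  exact dual_eq_zero_of_forall_apply_one_prod hc (forall_mem_range.2 hg)

lemma eventually_exists_flat_perturbation {f : ℝ → ℝ} (hf : ContDiff ℝ ∞ f) {k : ℕ}
    (P : C(X, ℝ) →L[ℝ] C(X, ℝ)) {v ρ₀ : C(X, ℝ)}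
    (hv : (0 : Fin k → ℝ) ∈ interior (convexHull ℝ (range ((gammaHatMap hf k).comp v))))
    (hρ₀ : mean μ ρ₀ = 1) (hγ : moment μ ((gammaHatMap hf k).comp v) ρ₀ = 0)
    {U : Set C(X, ℝ)} (hU : U ∈ 𝓝 ρ₀) :
    ∀ᶠ ε in 𝓝 (0 : ℝ), ∃ ρ ∈ U, mean μ ρ = 1 ∧ ∃ (ζ g : ℝ → C(X, ℝ)) (β : ℝ → ℝ),
      gammaHat β k 0 = 0 ∧ ∀ᶠ s in 𝓝 0, mean μ (ρ * ζ s) = s ∧ mean μ (g s) = 0 ∧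
        (∀ x, g s x = ρ x * (f (v x + ζ s x) - f (v x) - β s)) ∧
        ∃ c : ℝ, ζ s = c • 1 - ε • P (g s) := by
  let Δ := increment ⟨f, hf.continuous⟩ v
  let g : C(X, ℝ) × C(X, ℝ) → C(X, ℝ) := fun p => Δ p - mean μ (Δ p) • p.1
  -- The multiple of `1` in `T` makes `∫ ρ T = 0`, so that `∫ ρ ζ = s` holds along the solutions.
  let T : C(X, ℝ) × C(X, ℝ) → C(X, ℝ) := fun p => mean μ (p.1 * P (g p)) • 1 - P (g p)
  have hΔ : ContDiff ℝ (1 + k : ℕ) Δ := contDiff_increment (hf.of_le (by exact_mod_cast le_top)) v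
  have hB : ContDiff ℝ (1 + k : ℕ) fun p => mean μ (Δ p) := by fun_prop
  have hT : ContDiff ℝ (1 + k : ℕ) T := by fun_prop
  filter_upwards [eventually_exists_flat_solution hT hB 1
    (fun ρ => gammaHat_mean_increment μ hf k ρ v) (mean μ) (mean_moment_surjective μ hv) hγ hU]
  rintro ε ⟨ρ, hρU, hρ, ζ, hζ, hflat⟩
  have hmean : mean μ ρ = 1 := hρ.trans hρ₀
  refine ⟨ρ, hρU, hmean, ζ, fun s => g (ρ, ζ s), _, hflat, ?_⟩
  filter_upwards [hζ] with s hs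
  refine ⟨?_, ?_, fun x => ?_, s + ε * mean μ (ρ * P (g (ρ, ζ s))), ?_⟩
  · rw [hs]
    simp [T, mul_add, mul_sub, hmean]
  · simp [g, hmean]
  · simp only [g, Δ, increment, ContinuousMap.sub_apply, ContinuousMap.mul_apply,
      ContinuousMap.comp_apply, ContinuousMap.add_apply, ContinuousMap.coe_mk,
      ContinuousMap.coe_smul, Pi.smul_apply, smul_eq_mul]
    ring
  · refine hs.trans ?_
    simp only [T]
    module

end FlatPerturbation

section Circle

/-- The continuous functions on the circle with values in `E`; a Banach algebra if `E = ℝ`. -/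
abbrev CircleFun (E : Type*) [TopologicalSpace E] : Type _ := C(UnitAddCircle, E)

/-- The continuous function on the circle defined by a continuous `1`-periodic function. -/
def CircleFun.ofPeriodic {u : ℝ → ℝ} (hp : Function.Periodic u 1) (hc : Continuous u) :
    CircleFun ℝ where
  toFun := hp.lift
  continuous_toFun := hc.quotient_lift _

namespace CircleFun

lemma ofPeriodic_coe {u : ℝ → ℝ} (hp : Function.Periodic u 1) (hc : Continuous u) (t : ℝ) :
    ofPeriodic hp hc t = u t := rfl

variable {E : Type*} [NormedAddCommGroup E]

lemma continuous_coe (h : CircleFun E) : Continuous fun t : ℝ => h t :=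
  h.continuous.comp (AddCircle.continuous_mk' 1)

lemma periodic_coe (h : CircleFun E) : Function.Periodic (fun t : ℝ => h t) 1 := fun t =>
  congrArg h (AddCircle.coe_add_period 1 t)

lemma intervalIntegrable_coe (h : CircleFun E) (a b : ℝ) :
    IntervalIntegrable (fun t : ℝ => h t) volume a b :=
  h.continuous_coe.intervalIntegrable a b

lemma mean_eq_intervalIntegral (h : CircleFun ℝ) (a : ℝ) :
    mean volume h = ∫ t in a..(a + 1), h t := by
  rw [mean_apply, UnitAddCircle.intervalIntegral_preimage a h]

lemma integral_add_natCast [NormedSpace ℝ E] (h : CircleFun E) (a : ℝ) (n : ℕ) :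
    ∫ t in a..(a + n), h t = (n : ℝ) • ∫ x : UnitAddCircle, h x := by
  rw [← UnitAddCircle.intervalIntegral_preimage a h]
  simpa [Nat.cast_smul_eq_nsmul] using
    h.periodic_coe.intervalIntegral_add_zsmul_eq n a h.intervalIntegrable_coe

lemma hasDerivAt_integral (h : CircleFun ℝ) (x : ℝ) :
    HasDerivAt (fun x : ℝ => ∫ t in (0 : ℝ)..x, h t) (h x) x :=
  (h.continuous_coe).integral_hasStrictDerivAt 0 x |>.hasDerivAt

lemma exists_coe_eq (x : UnitAddCircle) : ∃ t ∈ Icc (0 : ℝ) 1, (t : UnitAddCircle) = x := by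
  have h := AddCircle.coe_image_Icc_eq (1 : ℝ) 0
  rw [zero_add] at h
  exact h.superset (mem_univ x)

/-- The periodic primitive of `h - ∫ h` which vanishes at `0`. -/
noncomputable def primitiveFun (h : CircleFun ℝ) : CircleFun ℝ :=
  ofPeriodic (u := fun x => (∫ t in (0 : ℝ)..x, h t) - x * mean volume h)
    (fun x => by
      have hsplit := intervalIntegral.integral_add_adjacent_intervals
        (h.intervalIntegrable_coe 0 x) (h.intervalIntegrable_coe x (x + 1))
      simp only [← hsplit, ← mean_eq_intervalIntegral h x]
      ring)
    ((intervalIntegral.continuous_primitive h.intervalIntegrable_coe 0).sub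
      (continuous_id.mul continuous_const))

lemma primitiveFun_coe (h : CircleFun ℝ) (x : ℝ) :
    primitiveFun h x = (∫ t in (0 : ℝ)..x, h t) - x * mean volume h := rfl

lemma norm_primitiveFun_le (h : CircleFun ℝ) : ‖primitiveFun h‖ ≤ 2 * ‖h‖ := by
  have hint (a : ℝ) (ha : a ∈ Icc (0 : ℝ) 1) : ‖∫ t in (0 : ℝ)..a, h t‖ ≤ ‖h‖ := by
    refine (intervalIntegral.norm_integral_le_of_norm_le_const
      fun t _ => h.norm_coe_le_norm t).trans ?_
    rw [sub_zero, abs_of_nonneg ha.1]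
    exact mul_le_of_le_one_right (norm_nonneg h) ha.2
  refine (ContinuousMap.norm_le _ (by positivity)).2 fun x => ?_
  obtain ⟨a, ha, rfl⟩ := exists_coe_eq x
  have hmean : ‖a * mean volume h‖ ≤ ‖h‖ := by
    rw [norm_mul, Real.norm_of_nonneg ha.1, mean_eq_intervalIntegral h 0, zero_add]
    exact (mul_le_of_le_one_left (norm_nonneg _) ha.2).trans (hint 1 ⟨zero_le_one, le_rfl⟩)
  rw [primitiveFun_coe, two_mul]
  exact norm_sub_le_of_le (hint a ha) hmean

/-- `primitiveFun` as an operator. -/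
noncomputable def primitive : CircleFun ℝ →L[ℝ] CircleFun ℝ :=
  LinearMap.mkContinuous
    { toFun := primitiveFun
      map_add' := fun g h => ContinuousMap.ext fun x => by
        obtain ⟨a, -, rfl⟩ := exists_coe_eq x
        simp only [primitiveFun_coe, ContinuousMap.add_apply, map_add,
          intervalIntegral.integral_add (g.intervalIntegrable_coe 0 a)
            (h.intervalIntegrable_coe 0 a)]
        ring
      map_smul' := fun c h => ContinuousMap.ext fun x => by
        obtain ⟨a, -, rfl⟩ := exists_coe_eq x
        simp only [primitiveFun_coe, ContinuousMap.smul_apply, map_smul, smul_eq_mul,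
          intervalIntegral.integral_const_mul, RingHom.id_apply]
        ring } 2 norm_primitiveFun_le

lemma hasDerivAt_primitive {h : CircleFun ℝ} (hh : mean volume h = 0) (x : ℝ) :
    HasDerivAt (fun x : ℝ => primitive h x) (h x) x := by
  have hcoe : (fun x : ℝ => primitive h x) = fun x : ℝ => ∫ t in (0 : ℝ)..x, h t := by
    ext x
    exact (primitiveFun_coe h x).trans (by rw [hh, mul_zero, sub_zero])
  exact hcoe ▸ h.hasDerivAt_integral x

end CircleFun

end Circle

section Windings

/-- A parametrization of the circle with weight `ρ` which runs `n` times around it with velocity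
`n / ρ`. -/
structure IsWinding (ρ : CircleFun ℝ) (n : ℕ) (θ : ℝ → ℝ) : Prop where
  pos (x : UnitAddCircle) : 0 < ρ x
  hasDerivAt (t : ℝ) : HasDerivAt θ (n / ρ (θ t)) t
  map_add_one (t : ℝ) : θ (t + 1) = θ t + n

lemma exists_isWinding {ρ : CircleFun ℝ} (hpos : ∀ x, 0 < ρ x) (hρ : mean volume ρ = 1) (n : ℕ) :
    ∃ θ, IsWinding ρ n θ := by
  let τ : ℝ → ℝ := fun x => ∫ t in (0 : ℝ)..x, ρ t
  have hτ (x : ℝ) : HasDerivAt τ (ρ x) x := ρ.hasDerivAt_integral x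
  have hτn (x : ℝ) : τ (x + n) = τ x + n := by
    have h := ρ.integral_add_natCast x n
    rw [← mean_apply, hρ, smul_eq_mul, mul_one] at h
    refine Eq.trans ?_ (congrArg (τ x + ·) h)
    exact (intervalIntegral.integral_add_adjacent_intervals (ρ.intervalIntegrable_coe 0 x)
      (ρ.intervalIntegrable_coe x (x + n))).symm
  have hmono : StrictMono τ := strictMono_of_deriv_pos fun x => (hτ x).deriv ▸ hpos x
  have hone : 0 < ∫ t in (0 : ℝ)..1, ρ t := by
    have h := ρ.mean_eq_intervalIntegral 0
    rw [zero_add, hρ] at h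
    exact h ▸ one_pos
  have hsurj : Function.Surjective τ :=
    (continuous_iff_continuousAt.2 fun x => (hτ x).continuousAt).surjective
      (ρ.periodic_coe.tendsto_atTop_intervalIntegral_of_pos hone one_pos)
      (ρ.periodic_coe.tendsto_atBot_intervalIntegral_of_pos hone one_pos)
  let e := hmono.orderIsoOfSurjective τ hsurj
  have heτ (t : ℝ) : τ (e.symm t) = t := e.apply_symm_apply t
  have he (t : ℝ) : HasDerivAt e.symm (ρ (e.symm t))⁻¹ t :=
    (hτ (e.symm t)).of_local_left_inverse e.symm.continuous.continuousAt (hpos _).ne'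
      (.of_forall heτ)
  refine ⟨fun t => e.symm (n * t), hpos, fun t => ?_, fun t => hmono.injective ?_⟩
  · rw [div_eq_inv_mul]
    exact (he (n * t)).comp t (by simpa using (hasDerivAt_id t).const_mul (n : ℝ))
  · rw [heτ, hτn, heτ, mul_add, mul_one]

namespace IsWinding

variable {ρ : CircleFun ℝ} {n : ℕ} {θ : ℝ → ℝ}

lemma continuous (hθ : IsWinding ρ n θ) : Continuous θ :=
  continuous_iff_continuousAt.2 fun t => (hθ.hasDerivAt t).continuousAt

lemma periodic_comp (hθ : IsWinding ρ n θ) (g : CircleFun ℝ) :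
    Function.Periodic (fun t => g (θ t)) 1 := fun t => by
  simpa only [hθ.map_add_one, mul_one] using g.periodic_coe.nat_mul n (θ t)

lemma integral_comp (hθ : IsWinding ρ n θ) (hn : n ≠ 0) {E : Type*} [NormedAddCommGroup E]
    [NormedSpace ℝ E] [CompleteSpace E] (g : CircleFun E) :
    ∫ t in (0 : ℝ)..1, g (θ t) = moment volume g ρ := by
  have hn' : (n : ℝ) ≠ 0 := Nat.cast_ne_zero.2 hn
  let ρg : CircleFun E := ρ • g
  have hderiv : Continuous fun t => n / ρ (θ t) :=
    continuous_const.div (ρ.continuous_coe.comp hθ.continuous) fun t => (hθ.pos _).ne'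
  have hsubst := intervalIntegral.integral_deriv_smul_comp (a := 0) (b := 1)
    (fun t _ => hθ.hasDerivAt t) hderiv.continuousOn ρg.continuous_coe
  have hone : θ 1 = θ 0 + n := by simpa only [zero_add] using hθ.map_add_one 0
  rw [hone, ρg.integral_add_natCast] at hsubst
  rw [moment_apply]
  refine smul_right_injective E hn' (Eq.trans ?_ hsubst)
  dsimp only
  rw [← intervalIntegral.integral_smul]
  refine intervalIntegral.integral_congr fun t _ => ?_
  change (n : ℝ) • g (θ t) = (n / ρ (θ t)) • ρ (θ t) • g (θ t)
  rw [smul_smul, div_mul_cancel₀ _ (hθ.pos _).ne']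

lemma exists_C1 (hθ : IsWinding ρ n θ) {w w' : CircleFun ℝ}
    (hw : ∀ x : ℝ, HasDerivAt (fun x : ℝ => w x) (w' x) x) :
    ∃ u : C1, (∀ t, u.1 t = w (θ t)) ∧ ∀ t, deriv u.1 t = w' (θ t) * (n / ρ (θ t)) := by
  have hderiv (t : ℝ) : HasDerivAt (fun t => w (θ t)) (w' (θ t) * (n / ρ (θ t))) t :=
    (hw (θ t)).comp t (hθ.hasDerivAt t)
  refine ⟨⟨fun t => w (θ t), hθ.periodic_comp w, contDiff_one_iff_deriv.2
    ⟨fun t => (hderiv t).differentiableAt, ?_⟩⟩, fun t => rfl, fun t => (hderiv t).deriv⟩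
  rw [funext fun t => (hderiv t).deriv]
  exact (w'.continuous_coe.comp hθ.continuous).mul
    (continuous_const.div (ρ.continuous_coe.comp hθ.continuous) fun t => (hθ.pos _).ne')

end IsWinding

end Windings

section LinearEquation

lemma exists_integrating_factor {w a : ℝ → ℝ} {c : ℝ}
    (hw : ∀ x y, AbsolutelyContinuousOnInterval w x y) (ha : Continuous a)
    (heq : ∀ᵐ t ∂periodMeasure, deriv w t + a t * w t = c) :
    ∃ E : ℝ → ℝ, Continuous E ∧ (∀ t, 0 < E t) ∧ ∀ x ∈ Icc (0 : ℝ) 1, ∀ y ∈ Icc (0 : ℝ) 1,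
      w y * E y - w x * E x = c * ∫ t in x..y, E t := by
  let E : ℝ → ℝ := fun t => Real.exp (∫ s in (0 : ℝ)..t, a s)
  have hE (t : ℝ) : HasDerivAt E (E t * a t) t :=
    (ha.integral_hasStrictDerivAt 0 t).hasDerivAt.exp
  have hEc : Continuous E := continuous_iff_continuousAt.2 fun t => (hE t).continuousAt
  have hE₁ : ContDiff ℝ 1 E := contDiff_one_iff_deriv.2
    ⟨fun t => (hE t).differentiableAt, (funext fun t => (hE t).deriv) ▸ hEc.mul ha⟩
  refine ⟨E, hEc, fun t => Real.exp_pos _, fun x hx y hy => ?_⟩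
  rw [← (hw x y).integral_deriv_mul_eq_sub hE₁.contDiffOn.absolutelyContinuousOnInterval,
    ← intervalIntegral.integral_const_mul]
  refine intervalIntegral.integral_congr_ae ?_
  filter_upwards [(ae_restrict_iff' measurableSet_Ioc).1 heq] with t ht htxy
  have ht01 : t ∈ Ioc (0 : ℝ) 1 :=
    ⟨(le_min hx.1 hy.1).trans_lt htxy.1, htxy.2.trans (max_le hx.2 hy.2)⟩
  rw [(hE t).deriv, ← ht ht01]
  ring

lemma eq_zero_of_linear_equation {w a : ℝ → ℝ} {c : ℝ}
    (hw : ∀ x y, AbsolutelyContinuousOnInterval w x y) (hwc : Continuous w)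
    (hper : Function.Periodic w 1) (hmean : ∫ t in (0 : ℝ)..1, w t = 0) (ha : Continuous a)
    (heq : ∀ᵐ t ∂periodMeasure, deriv w t + a t * w t = c) : w = 0 := by
  obtain ⟨E, hEc, hEpos, hwE⟩ := exists_integrating_factor hw ha heq
  obtain ⟨t₀, ht₀, hw₀⟩ := exists_eq_interval_average zero_ne_one hwc.continuousOn
  rw [interval_average_eq, hmean, smul_zero] at hw₀
  rw [uIoo_of_lt one_pos] at ht₀
  have hint_pos {x y : ℝ} (hxy : x < y) : 0 < ∫ t in x..y, E t :=
    intervalIntegral.intervalIntegral_pos_of_pos (hEc.intervalIntegrable x y) hEpos hxy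
  have ht₀' := Ioo_subset_Icc_self ht₀
  have hleft := hwE 0 (left_mem_Icc.2 zero_le_one) t₀ ht₀'
  have hright := hwE t₀ ht₀' 1 (right_mem_Icc.2 zero_le_one)
  have hends : w 1 = w 0 := by simpa only [zero_add] using hper 0
  have hc : c = 0 := by
    have hpos := add_pos (mul_pos (hint_pos ht₀.1) (hEpos 1)) (mul_pos (hint_pos ht₀.2) (hEpos 0))
    refine (mul_eq_zero.1 ?_).resolve_right hpos.ne'
    rw [hw₀] at hleft hright
    rw [hends] at hright
    linear_combination -hleft * E 1 - hright * E 0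
  funext t
  obtain ⟨y, hy, hty⟩ := hper.exists_mem_Ico₀ one_pos t
  have hzero := hwE t₀ ht₀' y (Ico_subset_Icc_self hy)
  rw [hw₀, hc, zero_mul, zero_mul, sub_zero] at hzero
  exact hty.trans ((mul_eq_zero.1 hzero).resolve_right (hEpos y).ne')

lemma H1.ext_of_equation {f : ℝ → ℝ} (hf : ContDiff ℝ 1 f) {u₁ u₂ : H1} {c : ℝ}
    (hm : meanH1 u₁ = meanH1 u₂)
    (h : ∀ᵐ t ∂periodMeasure, deriv u₁.1 t + f (u₁.1 t) = deriv u₂.1 t + f (u₂.1 t) + c) :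
    u₁ = u₂ := by
  refine Subtype.ext (sub_eq_zero.1 (eq_zero_of_linear_equation (c := c)
    (a := fun t => meanSlope f (u₂.1 t, u₁.1 t)) (fun x y => (u₁.2.2.1 x y).sub (u₂.2.2.1 x y))
    (u₁.continuous.sub u₂.continuous) (u₁.2.1.sub u₂.2.1) ?_
    ((continuous_meanSlope hf).comp (u₂.continuous.prodMk u₁.continuous)) ?_))
  · refine (intervalIntegral.integral_sub (u₁.continuous.intervalIntegrable _ _)
      (u₂.continuous.intervalIntegrable _ _)).trans (sub_eq_zero.2 hm)
  · refine (ae_restrict_iff' measurableSet_Ioc).2 ?_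
    filter_upwards [(ae_restrict_iff' measurableSet_Ioc).1 h,
      (u₁.2.2.1 0 1).ae_differentiableAt, (u₂.2.2.1 0 1).ae_differentiableAt]
      with t ht hd₁ hd₂ ht01
    have ht01' : t ∈ uIcc (0 : ℝ) 1 := Ioc_subset_Icc_self.trans Icc_subset_uIcc ht01
    rw [deriv_sub (hd₁ ht01') (hd₂ ht01'), Pi.sub_apply, meanSlope_mul_sub hf]
    linarith [ht ht01]

/-- The inclusion of `C¹` in `H¹`. -/
def C1.toH1 (u : C1) : H1 :=
  ⟨u.1, u.2.1, fun _ _ => u.2.2.contDiffOn.absolutelyContinuousOnInterval,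
    memLp_of_continuous (u.2.2.continuous_deriv le_rfl)⟩

lemma C1.toH1_injective : Function.Injective C1.toH1 := fun _ _ h =>
  Subtype.ext (congrArg (fun u : H1 => u.1) h)

lemma C1.ext_of_equation {f : ℝ → ℝ} (hf : ContDiff ℝ 1 f) {u₁ u₂ : C1} {c : ℝ}
    (hm : meanC1 u₁ = meanC1 u₂)
    (h : ∀ t, deriv u₁.1 t + f (u₁.1 t) = deriv u₂.1 t + f (u₂.1 t) + c) : u₁ = u₂ :=
  C1.toH1_injective (H1.ext_of_equation hf hm (.of_forall h))

end LinearEquation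

section Strata

variable {B₁ B₀ : Type*} [AddCommGroup B₀] [Module ℝ B₀]
  {m₁ : B₁ → ℝ} {m₀ : B₀ → ℝ} {e : B₀} {G : B₁ → B₀}

lemma mean_adaptedMap (hm : IsLinearMap ℝ m₀) (he : m₀ e = 1) (u : B₁) :
    m₀ (adaptedMap m₁ m₀ e G u) = m₁ u := by
  simp [adaptedMap, hm.map_add, hm.map_sub, hm.map_smul, he]

lemma adaptedMap_injective (hm : IsLinearMap ℝ m₀) (he : m₀ e = 1)
    (hG : ∀ (u₁ u₂ : B₁) (c : ℝ), m₁ u₁ = m₁ u₂ → G u₁ = G u₂ + c • e → u₁ = u₂) :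
    Function.Injective (adaptedMap m₁ m₀ e G) := by
  intro u₁ u₂ h
  have hmean : m₁ u₁ = m₁ u₂ := by
    rw [← mean_adaptedMap (m₁ := m₁) (G := G) hm he u₁, h, mean_adaptedMap hm he]
  refine hG u₁ u₂ (m₀ (G u₁) - m₀ (G u₂)) hmean ?_
  simp only [adaptedMap, hmean, add_left_inj] at h
  rw [sub_smul, add_sub_left_comm, ← h]
  abel

lemma forall_iteratedDeriv_eq_zero_iff (β : ℝ → ℝ) (k : ℕ) (x : ℝ) :
    (∀ i, 1 ≤ i → i ≤ k → iteratedDeriv i β x = 0) ↔ gammaHat β k x = 0 := by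
  refine ⟨fun h => funext fun i => h (i + 1) (Nat.le_add_left 1 i) i.2, fun h i hi hik => ?_⟩
  obtain ⟨j, rfl⟩ := Nat.exists_eq_add_of_le' hi
  exact congrFun h ⟨j, hik⟩

lemma mem_stratum_iff [Nonempty B₁] (hm : IsLinearMap ℝ m₀) (he : m₀ e = 1)
    (hinj : Function.Injective (adaptedMap m₁ m₀ e G)) {u : B₁} {β : ℝ → ℝ}
    (hU : ∀ᶠ s in 𝓝 (0 : ℝ), ∃ U, G U = G u + β s • e ∧ m₁ U = m₁ u + s) (k : ℕ) :
    u ∈ stratum m₁ m₀ e G k ↔ gammaHat β k 0 = 0 := by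
  have hheight : (fun s : ℝ => height m₁ m₀ e G (adaptedMap m₁ m₀ e G u + s • e)) =ᶠ[𝓝 0]
      fun s => m₀ (G u) + β s := by
    filter_upwards [hU] with s ⟨U, hGU, hmU⟩
    have hadapted : adaptedMap m₁ m₀ e G u + s • e = adaptedMap m₁ m₀ e G U := by
      simp only [adaptedMap, hGU, hmU, hm.map_add, hm.map_smul, he, smul_eq_mul, mul_one]
      module
    rw [hadapted, height, Function.leftInverse_invFun hinj, hGU, hm.map_add, hm.map_smul, he,
      smul_eq_mul, mul_one]
  refine (forall_iteratedDeriv_eq_zero_iff _ k 0).trans ?_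
  rw [gammaHat_congr hheight, gammaHat_const_add]

end Strata

section Means

lemma isLinearMap_meanC0 : IsLinearMap ℝ meanC0 where
  map_add u v := intervalIntegral.integral_add (u.2.2.intervalIntegrable _ _)
    (v.2.2.intervalIntegrable _ _)
  map_smul c _ := intervalIntegral.integral_const_mul c _

lemma meanC0_one : meanC0 oneC0 = 1 := by simp [meanC0, oneC0]

lemma meanH0_eq_integral (v : H0) : meanH0 v = ∫ t, v t ∂periodMeasure :=
  intervalIntegral.integral_of_le zero_le_one

lemma isLinearMap_meanH0 : IsLinearMap ℝ meanH0 where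
  map_add u v := by
    simp only [meanH0_eq_integral]
    rw [← integral_add ((Lp.memLp u).integrable one_le_two) ((Lp.memLp v).integrable one_le_two)]
    exact integral_congr_ae (Lp.coeFn_add u v)
  map_smul c v := by
    rw [meanH0_eq_integral, meanH0_eq_integral, smul_eq_mul, ← integral_const_mul]
    exact integral_congr_ae (Lp.coeFn_smul c v)

lemma meanH0_one : meanH0 oneH0 = 1 := by
  rw [meanH0_eq_integral, oneH0, integral_congr_ae (MemLp.coeFn_toLp _)]
  simp

lemma eq_add_smul_oneC0_iff (v₁ v₂ : C0) (c : ℝ) :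
    v₁ = v₂ + c • oneC0 ↔ ∀ t, v₁.1 t = v₂.1 t + c := by
  rw [Subtype.ext_iff, funext_iff]
  refine forall_congr' fun t => ?_
  change v₁.1 t = v₂.1 t + c * 1 ↔ _
  rw [mul_one]

lemma toLp_eq_add_smul_oneH0_iff {g₁ g₂ : ℝ → ℝ} (h₁ : MemLp g₁ 2 periodMeasure)
    (h₂ : MemLp g₂ 2 periodMeasure) (c : ℝ) :
    h₁.toLp g₁ = h₂.toLp g₂ + c • oneH0 ↔ ∀ᵐ t ∂periodMeasure, g₁ t = g₂ t + c := by
  rw [oneH0, ← MemLp.toLp_const_smul, ← MemLp.toLp_add, MemLp.toLp_eq_toLp_iff]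
  simp only [EventuallyEq, Pi.add_apply, Pi.smul_apply, smul_eq_mul, mul_one]

end Means

section Injectivity

lemma injective_adaptedMap_opC (f : ℝ → ℝ) (hf : ContDiff ℝ ∞ f) :
    Function.Injective (adaptedMap meanC1 meanC0 oneC0 (opC f hf)) :=
  adaptedMap_injective isLinearMap_meanC0 meanC0_one fun _ _ c hm h =>
    C1.ext_of_equation (contDiff_infty.1 hf 1) hm ((eq_add_smul_oneC0_iff _ _ c).1 h)

lemma injective_adaptedMap_opH (f : ℝ → ℝ) (hf : ContDiff ℝ ∞ f) :
    Function.Injective (adaptedMap meanH1 meanH0 oneH0 (opH f hf)) :=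
  adaptedMap_injective isLinearMap_meanH0 meanH0_one fun _ _ c hm h =>
    H1.ext_of_equation (contDiff_infty.1 hf 1) hm ((toLp_eq_add_smul_oneH0_iff _ _ c).1 h)

lemma injective_adaptedMap_simpleOpC (f : ℝ → ℝ) :
    Function.Injective (adaptedMap meanC1 meanC0 oneC0 (simpleOpC f)) :=
  adaptedMap_injective isLinearMap_meanC0 meanC0_one fun u₁ u₂ c hm h =>
    C1.ext_of_equation (f := fun _ => 0)
      (c := (∫ s in (0 : ℝ)..1, f (u₂.1 s)) + c - ∫ s in (0 : ℝ)..1, f (u₁.1 s))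
      contDiff_const hm fun t => by
        have ht := (eq_add_smul_oneC0_iff _ _ c).1 h t
        dsimp only [simpleOpC] at ht
        linarith

lemma injective_adaptedMap_simpleOpH (f : ℝ → ℝ) :
    Function.Injective (adaptedMap meanH1 meanH0 oneH0 (simpleOpH f)) :=
  adaptedMap_injective isLinearMap_meanH0 meanH0_one fun u₁ u₂ c hm h =>
    H1.ext_of_equation (f := fun _ => 0)
      (c := (∫ s in (0 : ℝ)..1, f (u₂.1 s)) + c - ∫ s in (0 : ℝ)..1, f (u₁.1 s))
      contDiff_const hm (by
        filter_upwards [(toLp_eq_add_smul_oneH0_iff _ _ c).1 h] with t ht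
        linarith)

end Injectivity

section SimpleStrata

lemma gammaHat_integral_comp_add {f u : ℝ → ℝ} (hf : ContDiff ℝ ∞ f)
    (hp : Function.Periodic u 1) (hc : Continuous u) (k : ℕ) :
    gammaHat (fun s => -(∫ t in (0 : ℝ)..1, f (u t)) + ∫ t in (0 : ℝ)..1, f (u t + s)) k 0 =
      ∫ t in (0 : ℝ)..1, gammaHat f k (u t) := by
  let v := CircleFun.ofPeriodic hp hc
  have hper {E : Type} [NormedAddCommGroup E] [NormedSpace ℝ E] (g : ℝ → E) :
      ∫ t in (0 : ℝ)..1, g (u t) = ∫ x, g (v x) := by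
    simpa only [zero_add, v, CircleFun.ofPeriodic_coe] using
      UnitAddCircle.intervalIntegral_preimage 0 fun x => g (v x)
  have h := gammaHat_mean_mul_comp_add volume hf k 1 v
  simp only [moment_apply, ContinuousMap.one_apply, one_mul, one_smul] at h
  rw [gammaHat_const_add, hper]
  simp only [fun s => hper fun x => f (x + s)]
  exact h

lemma integral_add_const_period {u : ℝ → ℝ} (hc : Continuous u) (s : ℝ) :
    ∫ t in (0 : ℝ)..1, (u t + s) = (∫ t in (0 : ℝ)..1, u t) + s := by
  rw [intervalIntegral.integral_add (hc.intervalIntegrable 0 1) intervalIntegrable_const]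
  simp

lemma mem_simpleStrataC_iff {f : ℝ → ℝ} (hf : ContDiff ℝ ∞ f) (k : ℕ) (u : C1) :
    u ∈ simpleStrataC f k ↔ ∫ t in (0 : ℝ)..1, gammaHat f k (u.1 t) = 0 := by
  rw [← gammaHat_integral_comp_add hf u.2.1 u.2.2.continuous]
  refine mem_stratum_iff isLinearMap_meanC0 meanC0_one (injective_adaptedMap_simpleOpC f)
    (.of_forall fun s => ?_) k
  refine ⟨⟨fun t => u.1 t + s, fun t => by simp only [u.2.1 t], u.2.2.add contDiff_const⟩,
    (eq_add_smul_oneC0_iff _ _ _).2 fun t => ?_, integral_add_const_period u.2.2.continuous s⟩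
  simp only [simpleOpC, deriv_add_const]
  ring

lemma mem_simpleStrataH_iff {f : ℝ → ℝ} (hf : ContDiff ℝ ∞ f) (k : ℕ) (u : H1) :
    u ∈ simpleStrataH f k ↔ ∫ t in (0 : ℝ)..1, gammaHat f k (u.1 t) = 0 := by
  rw [← gammaHat_integral_comp_add hf u.2.1 u.continuous]
  refine mem_stratum_iff isLinearMap_meanH0 meanH0_one (injective_adaptedMap_simpleOpH f)
    (.of_forall fun s => ?_) k
  have hderiv : deriv (fun t => u.1 t + s) = deriv u.1 := funext fun t => deriv_add_const s
  refine ⟨⟨fun t => u.1 t + s, fun t => by simp only [u.2.1 t],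
    fun a b => (u.2.2.1 a b).add contDiffOn_const.absolutelyContinuousOnInterval,
    hderiv ▸ u.2.2.2⟩, (toLp_eq_add_smul_oneH0_iff _ _ _).2 (.of_forall fun t => ?_),
    integral_add_const_period u.continuous s⟩
  simp only [deriv_add_const]
  ring

end SimpleStrata

section Necessity

lemma IsGood.dual_eq_zero {f : ℝ → ℝ} {k : ℕ} (hk : IsGood f k) {a b : ℝ} (hab : a < b)
    {g : (Fin k → ℝ) →L[ℝ] ℝ} (hg : ∀ x ∈ Ioo a b, g (gammaHat f k x) = 0) : g = 0 := by
  by_contra hne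
  refine hk.2 a b hab g.toLinearMap.ker ?_ (image_subset_iff.2 hg)
  have hne' : g.toLinearMap ≠ 0 := fun h => hne (ContinuousLinearMap.coe_injective h)
  simpa using Module.Dual.finrank_ker_add_one_of_ne_zero hne'

lemma IsGood.exists_ne {f : ℝ → ℝ} {k : ℕ} (hk : IsGood f k) {u : ℝ → ℝ}
    (hint : ∫ t in (0 : ℝ)..1, gammaHat f k (u t) = 0) : ∃ t ∈ Icc (0 : ℝ) 1, u t ≠ u 0 := by
  by_contra! hconst
  refine hk.1 (u 0) (Eq.trans ?_ hint)
  rw [intervalIntegral.integral_congr (g := fun _ => gammaHat f k (u 0)) fun t ht => ?_]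
  · simp
  · simp only [hconst t (uIcc_of_le (zero_le_one' ℝ) ▸ ht)]

lemma eq_zero_of_nonpos_of_integral_eq_zero {h : ℝ → ℝ} (hc : Continuous h) (hle : ∀ t, h t ≤ 0)
    (hint : ∫ t in (0 : ℝ)..1, h t = 0) {t : ℝ} (ht : t ∈ Icc (0 : ℝ) 1) : h t = 0 := by
  by_contra hne
  have hpos := intervalIntegral.integral_pos one_pos hc.neg.continuousOn
    (fun s _ => neg_nonneg.2 (hle s)) ⟨t, ht, neg_pos.2 ((hle t).lt_of_ne hne)⟩
  simp only [Pi.neg_apply, intervalIntegral.integral_neg, hint, neg_zero] at hpos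
  exact hpos.false

lemma zero_mem_interior_of_integral_eq_zero {f : ℝ → ℝ} (hf : ContDiff ℝ ∞ f) {k : ℕ}
    (hk : IsGood f k) {u : ℝ → ℝ} (hc : Continuous u)
    (hint : ∫ t in (0 : ℝ)..1, gammaHat f k (u t) = 0) :
    (0 : Fin k → ℝ) ∈ interior (convexHull ℝ (range (gammaHat f k))) := by
  refine (zero_mem_interior_convexHull_iff (range_nonempty _)).2 fun g hg => ?_
  have hγ : Continuous fun t => gammaHat f k (u t) := (gammaHatMap hf k).continuous.comp hc
  have hgint : ∫ t in (0 : ℝ)..1, g (gammaHat f k (u t)) = 0 := by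
    rw [g.intervalIntegral_comp_comm (hγ.intervalIntegrable 0 1), hint, map_zero]
  have hgu {t : ℝ} (ht : t ∈ Icc (0 : ℝ) 1) : g (gammaHat f k (u t)) = 0 :=
    eq_zero_of_nonpos_of_integral_eq_zero (g.continuous.comp hγ) (fun t => hg _ ⟨u t, rfl⟩) hgint ht
  obtain ⟨t, ht, hne⟩ := hk.exists_ne hint
  refine hk.dual_eq_zero (inf_lt_sup.2 hne.symm) fun x hx => ?_
  obtain ⟨s, hs, rfl⟩ := intermediate_value_uIcc (hc.continuousOn (s := uIcc 0 t))
    (Ioo_subset_Icc_self hx)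
  exact hgu (uIcc_subset_Icc (left_mem_Icc.2 zero_le_one) ht hs)

end Necessity

section Sufficiency

/-- The loop `R sin (2πt)`, which runs through `[-R, R]`. -/
noncomputable def sine (R : ℝ) : CircleFun ℝ :=
  CircleFun.ofPeriodic (u := fun t => R * Real.sin (2 * Real.pi * t))
    (fun t => by simp only [mul_add, mul_one, Real.sin_add_two_pi]) (by fun_prop)

/-- The derivative of `sine R`. -/
noncomputable def sineDeriv (R : ℝ) : CircleFun ℝ :=
  CircleFun.ofPeriodic (u := fun t => R * (Real.cos (2 * Real.pi * t) * (2 * Real.pi)))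
    (fun t => by simp only [mul_add, mul_one, Real.cos_add_two_pi]) (by fun_prop)

lemma hasDerivAt_sine (R x : ℝ) : HasDerivAt (fun x : ℝ => sine R x) (sineDeriv R x) x := by
  have h := ((hasDerivAt_id x).const_mul (2 * Real.pi)).sin.const_mul R
  rwa [mul_one] at h

lemma Icc_subset_range_sine (R : ℝ) : Icc (-R) R ⊆ range (sine R) := by
  have hend (τ : ℝ) : sine R τ = R * Real.sin (2 * Real.pi * τ) := rfl
  have hl : sine R ((-1 / 4 : ℝ) : UnitAddCircle) = -R := by
    rw [hend, show 2 * Real.pi * (-1 / 4) = -(Real.pi / 2) by ring, Real.sin_neg,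
      Real.sin_pi_div_two, mul_neg_one]
  have hr : sine R ((1 / 4 : ℝ) : UnitAddCircle) = R := by
    rw [hend, show 2 * Real.pi * (1 / 4) = Real.pi / 2 by ring, Real.sin_pi_div_two, mul_one]
  intro y hy
  exact mem_range_of_exists_le_of_exists_ge (sine R).continuous ⟨_, hl.trans_le hy.1⟩
    ⟨_, hy.2.trans hr.ge⟩

lemma exists_sine_zero_mem_interior {f : ℝ → ℝ} (hf : ContDiff ℝ ∞ f) {k : ℕ}
    (h : (0 : Fin k → ℝ) ∈ interior (convexHull ℝ (range (gammaHat f k)))) :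
    ∃ R, (0 : Fin k → ℝ) ∈
      interior (convexHull ℝ (range ((gammaHatMap hf k).comp (sine R)))) := by
  have hmono : Monotone fun n : ℕ => gammaHat f k '' Icc (-n : ℝ) n := fun m n hmn =>
    image_mono (Icc_subset_Icc (neg_le_neg (Nat.cast_le.2 hmn)) (Nat.cast_le.2 hmn))
  have hunion : ⋃ n : ℕ, gammaHat f k '' Icc (-n : ℝ) n = range (gammaHat f k) := by
    rw [← image_iUnion, ← image_univ]
    refine congrArg _ (eq_univ_of_forall fun x => mem_iUnion.2 ?_)
    exact (exists_nat_ge |x|).imp fun n hn => abs_le.1 hn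
  obtain ⟨n, hn⟩ := exists_mem_interior_convexHull_of_iUnion hmono (hunion ▸ h)
  refine ⟨n, interior_mono (convexHull_mono ?_) hn⟩
  rw [ContinuousMap.coe_comp, range_comp]
  exact image_mono (Icc_subset_range_sine n)

end Sufficiency

section Existence

lemma exists_C1_integral_gammaHat_eq_zero {f : ℝ → ℝ} (hf : ContDiff ℝ ∞ f) {k : ℕ}
    (h : (0 : Fin k → ℝ) ∈ interior (convexHull ℝ (range (gammaHat f k)))) :
    ∃ u : C1, ∫ t in (0 : ℝ)..1, gammaHat f k (u.1 t) = 0 := by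
  obtain ⟨R, hR⟩ := exists_sine_zero_mem_interior hf h
  obtain ⟨ρ, hpos, hρ, hγ⟩ := exists_pos_mean_eq_one_moment_eq_zero volume hR
  obtain ⟨θ, hθ⟩ := exists_isWinding hpos hρ 1
  obtain ⟨u, hu, -⟩ := hθ.exists_C1 (hasDerivAt_sine R)
  refine ⟨u, ?_⟩
  simp only [hu]
  exact (hθ.integral_comp one_ne_zero _).trans hγ

lemma IsWinding.exists_C1_equation {ρ : CircleFun ℝ} {n : ℕ} {θ : ℝ → ℝ} (hθ : IsWinding ρ n θ)
    (hn : n ≠ 0) {f : ℝ → ℝ} {v v' ζ g : CircleFun ℝ} {b c : ℝ}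
    (hv : ∀ x : ℝ, HasDerivAt (fun x : ℝ => v x) (v' x) x) (hg₀ : mean volume g = 0)
    (hg : ∀ x, g x = ρ x * (f (v x + ζ x) - f (v x) - b))
    (hζ : ζ = c • 1 - (n : ℝ)⁻¹ • CircleFun.primitive g) :
    ∃ u : C1, (∀ t, deriv u.1 t + f (u.1 t) = v' (θ t) * (n / ρ (θ t)) + f (v (θ t)) + b) ∧
      meanC1 u = mean volume (ρ * v) + mean volume (ρ * ζ) := by
  have hderiv (x : ℝ) :
      HasDerivAt (fun x : ℝ => (v + ζ) x) ((v' - (n : ℝ)⁻¹ • g) x) x := by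
    subst hζ
    have h := (hv x).add
      (((CircleFun.hasDerivAt_primitive hg₀ x).const_mul (n : ℝ)⁻¹).const_sub c)
    convert! h using 2
    simp
  obtain ⟨u, hu, hu'⟩ := hθ.exists_C1 hderiv
  refine ⟨u, fun t => ?_, ?_⟩
  · have hn' : (n : ℝ) ≠ 0 := Nat.cast_ne_zero.2 hn
    have hρ := (hθ.pos (θ t)).ne'
    rw [hu', hu]
    simp only [ContinuousMap.sub_apply, ContinuousMap.smul_apply, ContinuousMap.add_apply, hg,
      smul_eq_mul]
    field_simp
    ring
  · simp only [meanC1, hu]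
    rw [hθ.integral_comp hn, ← map_add, ← mul_add, mean_apply]
    rfl

lemma exists_C1_flat_family {f : ℝ → ℝ} (hf : ContDiff ℝ ∞ f) {k : ℕ}
    (h : (0 : Fin k → ℝ) ∈ interior (convexHull ℝ (range (gammaHat f k)))) :
    ∃ (u : C1) (β : ℝ → ℝ), gammaHat β k 0 = 0 ∧ ∀ᶠ s in 𝓝 (0 : ℝ), ∃ U : C1,
      (∀ t, deriv U.1 t + f (U.1 t) = deriv u.1 t + f (u.1 t) + β s) ∧
        meanC1 U = meanC1 u + s := by
  obtain ⟨R, hR⟩ := exists_sine_zero_mem_interior hf h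
  obtain ⟨ρ₀, hpos₀, hρ₀, hγ₀⟩ := exists_pos_mean_eq_one_moment_eq_zero volume hR
  have hpos_nhds : {ρ : CircleFun ℝ | ∀ x, 0 < ρ x} ∈ 𝓝 ρ₀ := by
    filter_upwards [ContinuousMap.eventually_mapsTo isCompact_univ isOpen_Ioi fun x _ => hpos₀ x]
      with ρ hρ x using hρ (mem_univ x)
  obtain ⟨n, ⟨ρ, hpos, hρ, ζ, g, β, hβ, hζ⟩, hn⟩ :=
    ((tendsto_inv_atTop_nhds_zero_nat.eventually (eventually_exists_flat_perturbation volume hf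
      CircleFun.primitive hR hρ₀ hγ₀ hpos_nhds)).and (eventually_ne_atTop 0)).exists
  obtain ⟨θ, hθ⟩ := exists_isWinding hpos hρ n
  have hU : ∀ᶠ s in 𝓝 (0 : ℝ), ∃ U : C1,
      (∀ t, deriv U.1 t + f (U.1 t) =
        sineDeriv R (θ t) * (n / ρ (θ t)) + f (sine R (θ t)) + β s) ∧
        meanC1 U = mean volume (ρ * sine R) + s := by
    filter_upwards [hζ] with s ⟨hmean, hg₀, hg, c, hc⟩
    have hU := hθ.exists_C1_equation hn (hasDerivAt_sine R) hg₀ hg hc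
    rwa [hmean] at hU
  obtain ⟨u, hu, hmu⟩ := hU.self_of_nhds
  refine ⟨u, fun s => -β 0 + β s, by rw [gammaHat_const_add, hβ], ?_⟩
  filter_upwards [hU] with s ⟨U, hU, hmU⟩
  refine ⟨U, fun t => ?_, by rw [hmU, hmu, add_zero]⟩
  rw [hU, hu]
  ring

end Existence

section Nonempty

lemma simpleStrataC_nonempty_iff {f : ℝ → ℝ} (hf : ContDiff ℝ ∞ f) {k : ℕ} (hk : IsGood f k) :
    (simpleStrataC f k).Nonempty ↔
      (0 : Fin k → ℝ) ∈ interior (convexHull ℝ (range (gammaHat f k))) := by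
  simp only [Set.Nonempty, mem_simpleStrataC_iff hf]
  exact ⟨fun ⟨u, hu⟩ => zero_mem_interior_of_integral_eq_zero hf hk u.2.2.continuous hu,
    exists_C1_integral_gammaHat_eq_zero hf⟩

lemma simpleStrataH_nonempty_iff {f : ℝ → ℝ} (hf : ContDiff ℝ ∞ f) {k : ℕ} (hk : IsGood f k) :
    (simpleStrataH f k).Nonempty ↔
      (0 : Fin k → ℝ) ∈ interior (convexHull ℝ (range (gammaHat f k))) := by
  simp only [Set.Nonempty, mem_simpleStrataH_iff hf]
  refine ⟨fun ⟨u, hu⟩ => zero_mem_interior_of_integral_eq_zero hf hk u.continuous hu, fun h => ?_⟩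
  obtain ⟨u, hu⟩ := exists_C1_integral_gammaHat_eq_zero hf h
  exact ⟨u.toH1, hu⟩

lemma strataC_nonempty {f : ℝ → ℝ} (hf : ContDiff ℝ ∞ f) {k : ℕ}
    (h : (0 : Fin k → ℝ) ∈ interior (convexHull ℝ (range (gammaHat f k)))) :
    (strataC f hf k).Nonempty := by
  obtain ⟨u, β, hβ, hU⟩ := exists_C1_flat_family hf h
  refine ⟨u, (mem_stratum_iff isLinearMap_meanC0 meanC0_one (injective_adaptedMap_opC f hf)
    (hU.mono fun s ⟨U, hU, hmU⟩ => ⟨U, ?_, hmU⟩) k).2 hβ⟩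
  exact (eq_add_smul_oneC0_iff _ _ _).2 hU

lemma strataH_nonempty {f : ℝ → ℝ} (hf : ContDiff ℝ ∞ f) {k : ℕ}
    (h : (0 : Fin k → ℝ) ∈ interior (convexHull ℝ (range (gammaHat f k)))) :
    (strataH f hf k).Nonempty := by
  obtain ⟨u, β, hβ, hU⟩ := exists_C1_flat_family hf h
  refine ⟨u.toH1, (mem_stratum_iff isLinearMap_meanH0 meanH0_one (injective_adaptedMap_opH f hf)
    (u := u.toH1) (hU.mono fun s ⟨U, hU, hmU⟩ => ⟨U.toH1, ?_, hmU⟩) k).2 hβ⟩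
  exact (toLp_eq_add_smul_oneH0_iff _ _ _).2 (.of_forall hU)

end Nonempty

end PeriodicODE

theorem lemma3p5 (f : ℝ → ℝ) (hf : ContDiff ℝ ∞ f) (k : ℕ) (hk : PeriodicODE.IsGood f k) :
    (((PeriodicODE.simpleStrataC f k).Nonempty ↔
        (0 : Fin k → ℝ) ∈ interior (convexHull ℝ (Set.range (PeriodicODE.gammaHat f k)))) ∧
      ((PeriodicODE.simpleStrataC f k).Nonempty → (PeriodicODE.strataC f hf k).Nonempty)) ∧
    (((PeriodicODE.simpleStrataH f k).Nonempty ↔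
        (0 : Fin k → ℝ) ∈ interior (convexHull ℝ (Set.range (PeriodicODE.gammaHat f k)))) ∧
      ((PeriodicODE.simpleStrataH f k).Nonempty → (PeriodicODE.strataH f hf k).Nonempty)) := by
  have hC := PeriodicODE.simpleStrataC_nonempty_iff hf hk
  have hH := PeriodicODE.simpleStrataH_nonempty_iff hf hk
  exact ⟨⟨hC, fun h => PeriodicODE.strataC_nonempty hf (hC.1 h)⟩,
    hH, fun h => PeriodicODE.strataH_nonempty hf (hH.1 h)⟩
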